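/- Let $B_3=\langle\sigma_1,\sigma_2\mid\sigma_1\sigma_2\sigma_1=\sigma_2\sigma_1\sigma_2\rangle$ be the three-strand braid group. Let $K\subset S^3$ be a (tame, i.e. locally flat) knot and $x\in S^3\setminus K$. A simple $B_3$-coloring of $K$ is a homomorphism or antihomomorphism $\pi_1(S^3\setminus K,x)\to B_3$ that sends every meridian of $K$ (with either orientation) to a conjugate of $\sigma_1$ or of $\sigma_1^{-1}$; it is non-trivial if it is not constant on meridians, that is, if there are two meridians whose images are neither equal nor inverse to each other. If $K$ has a non-trivial simple $B_3$-coloring, then there is an epimorphism from the knot group $\pi_1(S^3\setminus K,x)$ onto $B_3$. -/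

import Mathlib

open Topology

noncomputable section

/-- The three-strand braid group in Artin's presentation
`⟨σ₁, σ₂ | σ₁ σ₂ σ₁ = σ₂ σ₁ σ₂⟩`. -/
abbrev B3 : Type :=
  PresentedGroup
    ({FreeGroup.of 0 * FreeGroup.of 1 * FreeGroup.of 0 *
        (FreeGroup.of 1 * FreeGroup.of 0 * FreeGroup.of 1)⁻¹} : Set (FreeGroup (Fin 2)))

/-- The Artin generator `σ₁` of `B3`. -/
def B3.sigma1 : B3 := PresentedGroup.of 0

/-- The three-sphere. -/
abbrev S3 : Type := Metric.sphere (0 : EuclideanSpace ℝ (Fin 4)) 1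

/-- A flat chart of `S3` along `K`: an open embedding of `ℂ × ℝ ≅ ℝ³` into `S3` under which `K`
corresponds exactly to the axis `{0} × ℝ`. -/
structure FlatChart (K : Set S3) where
  toFun : ℂ × ℝ → S3
  isOpenEmbedding : IsOpenEmbedding toFun
  mem_iff : ∀ (z : ℂ) (t : ℝ), toFun (z, t) ∈ K ↔ z = 0

/-- A (tame) knot in `S3`: a locally flat, topologically embedded circle. -/
structure IsKnot (K : Set S3) : Prop where
  exists_embedding : ∃ f : Circle → S3, IsEmbedding f ∧ Set.range f = K
  locally_flat : ∀ y ∈ K, ∃ h : FlatChart K, y ∈ Set.range h.toFun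

/-- The complement of `K` in `S3`. -/
abbrev KnotComplement (K : Set S3) : Type := {y : S3 // y ∉ K}

/-- The knot group `π₁(S³ ∖ K, x)`. -/
abbrev KnotGroup (K : Set S3) (x : KnotComplement K) : Type :=
  FundamentalGroup (KnotComplement K) x

/-- The point of the complement with coordinates `(1, 0)` in a flat chart. -/
def FlatChart.base {K : Set S3} (h : FlatChart K) : KnotComplement K :=
  ⟨h.toFun (1, 0), fun hm => one_ne_zero ((h.mem_iff 1 0).1 hm)⟩

/-- The loop `s ↦ (exp (2 π i s), 0)` around the axis of a flat chart. -/
def FlatChart.circle {K : Set S3} (h : FlatChart K) : Path h.base h.base where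
  toFun s := ⟨h.toFun (Complex.exp (2 * Real.pi * Complex.I * ((s : ℝ) : ℂ)), 0),
    fun hm => Complex.exp_ne_zero _ ((h.mem_iff _ 0).1 hm)⟩
  continuous_toFun :=
    (h.isOpenEmbedding.continuous.comp (by fun_prop)).subtype_mk _
  source' := by
    apply Subtype.ext
    simp [FlatChart.base]
  target' := by
    apply Subtype.ext
    simp [FlatChart.base, Complex.exp_two_pi_mul_I]

/-- `g` is a meridian of `K` based at `x`: it is represented by a loop that runs along a path to a
small circle around `K`, once around that circle, and back along the same path. Both orientations
of the small circle occur, as a flat chart may be composed with complex conjugation. -/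
def IsMeridian (K : Set S3) (x : KnotComplement K) (g : KnotGroup K x) : Prop :=
  ∃ (h : FlatChart K) (p : Path x h.base),
    g = FundamentalGroup.fromPath
      (Path.Homotopic.Quotient.mk ((p.trans h.circle).trans p.symm))

/-- A `G`-coloring of `K`: a homomorphism or an antihomomorphism from the knot group to `G`. -/
def IsColoring {G : Type*} [Group G] (K : Set S3) (x : KnotComplement K)
    (c : KnotGroup K x → G) : Prop :=
  (∀ a b, c (a * b) = c a * c b) ∨ (∀ a b, c (a * b) = c b * c a)

/-- A simple `B3`-coloring of `K`: a coloring that sends meridians to half twists, that is, to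
conjugates of `σ₁` or of `σ₁⁻¹` (the sign depends on the orientation of the meridian). -/
structure IsSimpleB3Coloring (K : Set S3) (x : KnotComplement K)
    (c : KnotGroup K x → B3) : Prop where
  isColoring : IsColoring K x c
  meridian : ∀ m, IsMeridian K x m →
    IsConj B3.sigma1 (c m) ∨ IsConj B3.sigma1⁻¹ (c m)

/-- A coloring is non-trivial if it is not constant on meridians. As meridians are not oriented
here, and reversing a meridian inverts its color, colors are compared up to inversion. -/
def IsNontrivialColoring {G : Type*} [Group G] (K : Set S3) (x : KnotComplement K)
    (c : KnotGroup K x → G) : Prop :=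
  ∃ m m', IsMeridian K x m ∧ IsMeridian K x m' ∧ c m ≠ c m' ∧ c m ≠ (c m')⁻¹

end

/-! Topology enters only through the meridians: up to inversion, the image `H` of the coloring
contains two distinct conjugates of `σ₁`, and every such subgroup of `B3` maps onto `B3`.

Write Δ for `garside`, ρ for `rotation`. Then `B3` is generated by Δ and ρ with the single relation
Δ² = ρ³, whose two sides are the central full twist. Let X be the set of cosets of `H` times the
center. A cocycle on X is a labelling of the Δ- and ρ-edges of the Schreier graph subject to one
relation per point, and it restricts to a homomorphism on the stabilizer of the base point. As in
Kurosh's theorem, fixed points of Δ, of ρ and of `σ₁` = ρ⁻¹Δ are short loops that can carry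
noncentral labels while all points stay joined by centrally labelled paths
(`exists_cocycle_of_loops`). Two loops labelled Δ and ρ thus give a homomorphism on `H` that is onto
modulo the center, and `exists_surjective_of_surjective_mod_center` makes it onto.

Such loops exist unless Δ and ρ act freely and the two conjugates of `σ₁` yield the same fixed
point. In that case `H` is free modulo a central subgroup (`exists_free_cocycle`). A free quotient
of rank at least two maps onto the two-generator group `B3`; otherwise `H` is commutative. But the
common fixed point makes the two conjugates conjugate in `H`, so commutativity would force them to
be equal. -/

namespace B3

/-! ### The presentation with generators Δ, ρ and relation Δ² = ρ³ -/

/-- The Artin generator `σ₂`. -/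
def sigma2 : B3 := PresentedGroup.of 1

/-- The half twist on all three strands, `σ₁ σ₂ σ₁`. -/
def garside : B3 := sigma1 * sigma2 * sigma1

/-- The rotation `σ₁ σ₂`, a cube root of the full twist. -/
def rotation : B3 := sigma1 * sigma2

/-- The full twist, a generator of the center. -/
def fullTwist : B3 := garside * garside

theorem braid_relation : sigma1 * sigma2 * sigma1 = sigma2 * sigma1 * sigma2 := by
  have h : PresentedGroup.mk
      ({FreeGroup.of 0 * FreeGroup.of 1 * FreeGroup.of 0 *
        (FreeGroup.of 1 * FreeGroup.of 0 * FreeGroup.of 1)⁻¹} : Set (FreeGroup (Fin 2)))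
      (FreeGroup.of 0 * FreeGroup.of 1 * FreeGroup.of 0 *
        (FreeGroup.of 1 * FreeGroup.of 0 * FreeGroup.of 1)⁻¹) = 1 :=
    PresentedGroup.one_of_mem rfl
  rw [map_mul, map_inv, mul_inv_eq_one] at h
  simp only [map_mul] at h
  exact h

theorem rotation_cubed : rotation * (rotation * rotation) = fullTwist := by
  have h := braid_relation
  calc rotation * (rotation * rotation)
      = sigma1 * sigma2 * sigma1 * (sigma2 * sigma1 * sigma2) := by
        simp only [rotation, mul_assoc]
    _ = fullTwist := by rw [← h]; rfl

theorem rotation_zpow_three : rotation ^ (3 : ℤ) = fullTwist := by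
  rw [← rotation_cubed, ← pow_two, ← pow_succ']; rfl

theorem sigma1_eq : sigma1 = rotation⁻¹ * garside := by
  rw [eq_inv_mul_iff_mul_eq]
  rfl

theorem sigma2_eq : sigma2 = garside⁻¹ * (rotation * rotation) := by
  rw [eq_inv_mul_iff_mul_eq]
  simp only [garside, rotation, mul_assoc]

theorem closure_garside_rotation : Subgroup.closure {garside, rotation} = ⊤ := by
  have hg : garside ∈ Subgroup.closure {garside, rotation} := Subgroup.subset_closure (by simp)
  have hr : rotation ∈ Subgroup.closure {garside, rotation} := Subgroup.subset_closure (by simp)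
  refine eq_top_iff.2 fun b _ => PresentedGroup.generated_by _ _ (fun j => ?_) b
  fin_cases j
  · change sigma1 ∈ _
    rw [sigma1_eq]
    exact mul_mem (inv_mem hr) hg
  · change sigma2 ∈ _
    rw [sigma2_eq]
    exact mul_mem (inv_mem hg) (mul_mem hr hr)

theorem mem_of_generators {S : Subgroup B3} (hg : garside ∈ S) (hr : rotation ∈ S) (b : B3) :
    b ∈ S := by
  have : Subgroup.closure {garside, rotation} ≤ S := by
    rw [Subgroup.closure_le]
    rintro _ (rfl | rfl) <;> assumption
  exact this (closure_garside_rotation ▸ Subgroup.mem_top b)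

@[elab_as_elim]
theorem induction_left {P : B3 → Prop} (b : B3) (one : P 1)
    (garside_mul : ∀ b, P b → P (garside * b)) (garside_inv_mul : ∀ b, P b → P (garside⁻¹ * b))
    (rotation_mul : ∀ b, P b → P (rotation * b))
    (rotation_inv_mul : ∀ b, P b → P (rotation⁻¹ * b)) : P b := by
  have hb : b ∈ Subgroup.closure {garside, rotation} :=
    closure_garside_rotation ▸ Subgroup.mem_top b
  induction hb using Subgroup.closure_induction_left with
  | one => exact one
  | mul_left x hx y _ h =>
    obtain rfl | rfl := hx
    exacts [garside_mul _ h, rotation_mul _ h]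
  | inv_mul_cancel x hx y _ h =>
    obtain rfl | rfl := hx
    exacts [garside_inv_mul _ h, rotation_inv_mul _ h]

/-- As Δ² it commutes with Δ, and as ρ³ with ρ; these two generate. -/
theorem fullTwist_comm (b : B3) : fullTwist * b = b * fullTwist := by
  have : b ∈ Subgroup.centralizer {fullTwist} := by
    refine mem_of_generators ?_ ?_ b
    · rw [Subgroup.mem_centralizer_singleton_iff]
      simp only [fullTwist, mul_assoc]
    · rw [Subgroup.mem_centralizer_singleton_iff]
      simp only [← rotation_cubed, mul_assoc]
  exact (Subgroup.mem_centralizer_singleton_iff.1 this).symm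

theorem fullTwist_zpow_comm (j : ℤ) (b : B3) : fullTwist ^ j * b = b * fullTwist ^ j :=
  (show Commute fullTwist b from fullTwist_comm b).zpow_left j

/-- The homomorphism out of `B3` determined by the images of the Garside element and the
rotation. -/
def lift {G : Type*} [Group G] (p q : G) (h : p * p = q * (q * q)) : B3 →* G :=
  PresentedGroup.toGroup (f := ![q⁻¹ * p, p⁻¹ * (q * q)]) (by
    rintro _ rfl
    have h' : p⁻¹ * (q * (q * q)) = p := by rw [← h]; group
    simp only [map_mul, map_inv, FreeGroup.lift_apply_of, Matrix.cons_val_zero, Matrix.cons_val_one]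
    rw [mul_inv_eq_one]
    calc q⁻¹ * p * (p⁻¹ * (q * q)) * (q⁻¹ * p) = p := by group
      _ = p⁻¹ * (q * (q * q)) := h'.symm
      _ = p⁻¹ * (q * q) * (q⁻¹ * p) * (p⁻¹ * (q * q)) := by group)

section lift

variable {G : Type*} [Group G] (p q : G) (h : p * p = q * (q * q))

theorem lift_sigma1 : lift p q h sigma1 = q⁻¹ * p := PresentedGroup.toGroup.of _

theorem lift_sigma2 : lift p q h sigma2 = p⁻¹ * (q * q) := PresentedGroup.toGroup.of _

@[simp]
theorem lift_garside : lift p q h garside = p := by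
  simp only [garside, map_mul, lift_sigma1, lift_sigma2]
  group

@[simp]
theorem lift_rotation : lift p q h rotation = q := by
  simp only [rotation, map_mul, lift_sigma1, lift_sigma2]
  group

end lift

/-! ### Exponent sums and correction by central factors -/

/-- The exponent sum of a braid. -/
def exponentSum : B3 →* Multiplicative ℤ :=
  lift (Multiplicative.ofAdd 3) (Multiplicative.ofAdd 2) rfl

theorem exponentSum_garside : (exponentSum garside).toAdd = 3 := by simp [exponentSum]

theorem exponentSum_rotation : (exponentSum rotation).toAdd = 2 := by simp [exponentSum]

theorem exponentSum_fullTwist : (exponentSum fullTwist).toAdd = 6 := by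
  rw [fullTwist, map_mul, toAdd_mul, exponentSum_garside]; rfl

theorem exponentSum_fullTwist_zpow (j : ℤ) : (exponentSum (fullTwist ^ j)).toAdd = 6 * j := by
  rw [map_zpow, toAdd_zpow, exponentSum_fullTwist, smul_eq_mul, mul_comm]

/-- In the abelianization, a braid is the power of `σ₁` given by its exponent sum. -/
theorem mul_sigma1_zpow_mem_commutator (b : B3) :
    b * (sigma1 ^ (exponentSum b).toAdd)⁻¹ ∈ commutator B3 := by
  have h : (Abelianization.of : B3 →* Abelianization B3) =
      (zpowersHom _ (Abelianization.of sigma1)).comp exponentSum := by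
    have h12 : (Abelianization.of sigma2 : Abelianization B3) = Abelianization.of sigma1 := by
      have := congrArg (Abelianization.of : B3 →* Abelianization B3) braid_relation
      simp only [map_mul] at this
      rw [mul_right_comm, mul_comm (Abelianization.of sigma2)] at this
      exact (mul_left_cancel (mul_right_cancel this)).symm
    refine PresentedGroup.ext fun j => ?_
    fin_cases j
    · change Abelianization.of sigma1 = (zpowersHom (Abelianization B3) _) (exponentSum sigma1)
      simp [exponentSum, lift_sigma1, zpowersHom_apply]
    · change Abelianization.of sigma2 = (zpowersHom (Abelianization B3) _) (exponentSum sigma2)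
      simp [exponentSum, lift_sigma2, h12, zpowersHom_apply]
  have h' := DFunLike.congr_fun h b
  rw [← Abelianization.ker_of, MonoidHom.mem_ker, map_mul, map_inv, mul_inv_eq_one, h', map_zpow]
  rfl

/-- A homomorphism to `B3` that is onto modulo the center can be corrected by central elements so
as to become onto. -/
theorem exists_surjective_of_surjective_mod_center {H : Type*} [Group H] (φ : H →* B3)
    (hφ : ∀ b, ∃ (h : H) (j : ℤ), φ h = b * fullTwist ^ j) :
    ∃ f : H →* B3, Function.Surjective f := by
  obtain ⟨d, hd⟩ := Int.subgroup_cyclic ((exponentSum.comp φ).toAdditiveLeft.range)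
  have hdvd (h : H) : d ∣ (exponentSum (φ h)).toAdd := by
    have : (exponentSum (φ h)).toAdd ∈ (exponentSum.comp φ).toAdditiveLeft.range := ⟨h, rfl⟩
    rw [hd, AddSubgroup.mem_closure_singleton] at this
    obtain ⟨k, hk⟩ := this
    exact ⟨k, by rw [← hk, smul_eq_mul, mul_comm]⟩
  obtain ⟨h₀, hh₀⟩ : ∃ h : H, (exponentSum (φ h)).toAdd = d := by
    have : d ∈ (exponentSum.comp φ).toAdditiveLeft.range := hd ▸ AddSubgroup.mem_closure_of_mem rfl
    exact this
  obtain ⟨h₁, j₁, e₁⟩ := hφ garside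
  obtain ⟨h₂, j₂, e₂⟩ := hφ rotation
  have d₁ := hdvd h₁
  have d₂ := hdvd h₂
  rw [e₁, map_mul, toAdd_mul, exponentSum_garside, exponentSum_fullTwist_zpow] at d₁
  rw [e₂, map_mul, toAdd_mul, exponentSum_rotation, exponentSum_fullTwist_zpow] at d₂
  -- Lifts of Δ and ρ show that `d` divides a number that is 3 mod 6 and one that is 2 mod 6. So `d`
  -- is prime to 6, and one of `d`, `-d` is 1 mod 6.
  obtain ⟨e, k, hek, hedvd, h₃, hh₃⟩ : ∃ e k : ℤ, e = 1 + 6 * k ∧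
      (∀ h, e ∣ (exponentSum (φ h)).toAdd) ∧ ∃ h, (exponentSum (φ h)).toAdd = e := by
    obtain ⟨a₁, ha₁⟩ := d₁
    obtain ⟨a₂, ha₂⟩ := d₂
    have hmod : d % 6 = 1 ∨ d % 6 = 5 := by
      have h6 : d % 6 = 0 ∨ d % 6 = 1 ∨ d % 6 = 2 ∨ d % 6 = 3 ∨ d % 6 = 4 ∨ d % 6 = 5 := by omega
      have hd6 : d = 6 * (d / 6) + d % 6 := (Int.mul_ediv_add_emod d 6).symm
      generalize d / 6 = t at hd6
      rcases h6 with h | h | h | h | h | h <;> rw [h] at hd6 <;> subst hd6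
      · have : 3 + 6 * j₁ = 2 * (3 * t * a₁) := by rw [ha₁]; ring
        omega
      · omega
      · have : 3 + 6 * j₁ = 2 * ((3 * t + 1) * a₁) := by rw [ha₁]; ring
        omega
      · have : 2 + 6 * j₂ = 3 * ((2 * t + 1) * a₂) := by rw [ha₂]; ring
        omega
      · have : 3 + 6 * j₁ = 2 * ((3 * t + 2) * a₁) := by rw [ha₁]; ring
        omega
      · omega
    rcases hmod with h | h
    · exact ⟨d, d / 6, by omega, hdvd, h₀, hh₀⟩
    · refine ⟨-d, -(d / 6) - 1, by omega, fun h => (neg_dvd).2 (hdvd h), h₀⁻¹, ?_⟩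
      rw [map_inv, map_inv, toAdd_inv, hh₀]
  have he : e ≠ 0 := by omega
  choose n hn using hedvd
  have hn_mul (a b : H) : n (a * b) = n a + n b := by
    apply mul_left_cancel₀ he
    rw [mul_add, ← hn, ← hn, ← hn, map_mul, map_mul, toAdd_mul]
  -- The exponent sum of `φ h` is `(1 + 6 * k) * n h` and that of the full twist is 6, so the
  -- correction leaves exactly `n h`, which attains the value 1.
  let f : H →* B3 := MonoidHom.mk' (fun h => φ h * fullTwist ^ (-k * n h)) (fun a b => by
    have hc : fullTwist ^ (-k * n a) * φ b = φ b * fullTwist ^ (-k * n a) :=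
      fullTwist_zpow_comm _ _
    calc φ (a * b) * fullTwist ^ (-k * n (a * b))
        = φ a * (φ b * fullTwist ^ (-k * n a)) * fullTwist ^ (-k * n b) := by
          rw [map_mul, hn_mul, mul_add, zpow_add]; simp only [mul_assoc]
      _ = _ := by rw [← hc]; simp only [mul_assoc])
  have f_apply (h : H) : f h = φ h * fullTwist ^ (-k * n h) := rfl
  have hf (b : B3) : ∃ (h : H) (j : ℤ), f h = b * fullTwist ^ j := by
    obtain ⟨h, j, hj⟩ := hφ b
    exact ⟨h, j + -k * n h, by rw [f_apply, hj, mul_assoc, zpow_add]⟩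
  have hsum (h : H) : (exponentSum (f h)).toAdd = n h := by
    rw [f_apply, map_mul, toAdd_mul, hn, exponentSum_fullTwist_zpow, hek]; ring
  -- Central factors cancel in commutators, so being onto modulo the center is enough here.
  have hcomm : commutator B3 ≤ f.range := by
    rw [commutator_def, Subgroup.commutator_le]
    intro a _ b _
    obtain ⟨s, i, hs⟩ := hf a
    obtain ⟨t, j, ht⟩ := hf b
    refine ⟨s * t * s⁻¹ * t⁻¹, ?_⟩
    have c₁ (x : B3) : Commute (fullTwist ^ i) x := fullTwist_zpow_comm _ _
    have c₂ (x : B3) : Commute (fullTwist ^ j) x := fullTwist_zpow_comm _ _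
    generalize fullTwist ^ i = z at hs c₁
    generalize fullTwist ^ j = w at ht c₂
    simp only [map_mul, map_inv, hs, ht, commutatorElement_def]
    calc a * z * (b * w) * (a * z)⁻¹ * (b * w)⁻¹
        = a * (z * (b * (w * z⁻¹ * a⁻¹))) * w⁻¹ * b⁻¹ := by group
      _ = a * (b * (w * (z * z⁻¹) * a⁻¹)) * w⁻¹ * b⁻¹ := by
          rw [← mul_assoc z, (c₁ b).eq, mul_assoc b, ← mul_assoc z, ← mul_assoc z, (c₁ w).eq,
            mul_assoc w]
      _ = a * b * (w * a⁻¹) * w⁻¹ * b⁻¹ := by group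
      _ = a * b * a⁻¹ * b⁻¹ := by rw [(c₂ _).eq]; group
  have hone : sigma1 ∈ f.range := by
    have h1 := hcomm (mul_sigma1_zpow_mem_commutator (f h₃))
    have hn₃ : n h₃ = 1 := mul_left_cancel₀ he (by rw [← hn, hh₃, mul_one])
    rw [hsum, hn₃, zpow_one] at h1
    exact inv_mem_iff.1 ((Subgroup.mul_mem_cancel_left _ (MonoidHom.mem_range.2 ⟨h₃, rfl⟩)).1 h1)
  refine ⟨f, fun b => ?_⟩
  have hb := hcomm (mul_sigma1_zpow_mem_commutator b)
  exact (Subgroup.mul_mem_cancel_right _ (inv_mem (zpow_mem hone _))).1 hb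


/-! ### Cocycles on `B3`-sets -/

variable {X G : Type*} [MulAction B3 X] [Group G]

/-- A `G`-valued one-cocycle on the action groupoid of the `B3`-set `X`. -/
def IsCocycle (c : B3 → X → G) : Prop :=
  ∀ a b x, c (a * b) x = c a (b • x) * c b x

section Cocycle

variable {c : B3 → X → G} (hc : IsCocycle c)
include hc

theorem IsCocycle.map_one (x : X) : c 1 x = 1 := by
  have := hc 1 1 x
  rwa [one_smul, mul_one, left_eq_mul] at this

theorem IsCocycle.map_inv (a : B3) (x : X) : c a⁻¹ x = (c a (a⁻¹ • x))⁻¹ := by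
  have := hc a a⁻¹ x
  rw [mul_inv_cancel, hc.map_one] at this
  exact (inv_eq_of_mul_eq_one_right this.symm).symm

/-- A cocycle restricts to a homomorphism on every subgroup that fixes a point. -/
def IsCocycle.hom (H : Subgroup B3) (x : X) (hx : ∀ h ∈ H, h • x = x) : H →* G :=
  MonoidHom.mk' (fun h => c h x) fun a b => by
    rw [Subgroup.coe_mul, hc, hx b b.2]

end Cocycle

/-- The permutation of `X × G` given by `a` on `X` and by left multiplication by `p` on `G`. -/
def twistedPerm (a : B3) (p : X → G) : Equiv.Perm (X × G) where
  toFun y := (a • y.1, p y.1 * y.2)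
  invFun y := (a⁻¹ • y.1, (p (a⁻¹ • y.1))⁻¹ * y.2)
  left_inv y := by simp
  right_inv y := by simp

/-- A cocycle is given by its values on the Garside element and the rotation. -/
theorem exists_cocycle (p q : X → G)
    (h : ∀ x, p (garside • x) * p x =
      q (rotation • rotation • x) * (q (rotation • x) * q x)) :
    ∃ c : B3 → X → G, IsCocycle c ∧ (∀ x, c garside x = p x) ∧ ∀ x, c rotation x = q x := by
  let Φ : B3 →* Equiv.Perm (X × G) := lift (twistedPerm garside p) (twistedPerm rotation q) (by
    refine Equiv.ext fun y => Prod.ext ?_ ?_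
    · simp only [twistedPerm, Equiv.Perm.coe_mul, Function.comp_apply, Equiv.coe_fn_mk]
      rw [smul_smul, smul_smul, smul_smul, mul_assoc rotation, rotation_cubed]
      rfl
    · simp only [twistedPerm, Equiv.Perm.coe_mul, Function.comp_apply, Equiv.coe_fn_mk]
      rw [← mul_assoc, h]
      simp only [mul_assoc])
  have hg (y : X × G) : Φ garside y = (garside • y.1, p y.1 * y.2) := by
    simp only [Φ, lift_garside]; rfl
  have hr (y : X × G) : Φ rotation y = (rotation • y.1, q y.1 * y.2) := by
    simp only [Φ, lift_rotation]; rfl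
  -- Braids that act on each fibre over X by a left multiplication form a subgroup containing both
  -- generators; the multiplier is the cocycle.
  let S : Subgroup B3 :=
    { carrier := {b | ∀ x, ∃ k : G, ∀ m, Φ b (x, m) = (b • x, k * m)}
      one_mem' := fun x => ⟨1, fun m => by simp⟩
      mul_mem' := fun {a b} ha hb x => by
        obtain ⟨k, hk⟩ := hb x
        obtain ⟨l, hl⟩ := ha (b • x)
        exact ⟨l * k, fun m => by
          rw [map_mul, Equiv.Perm.mul_apply, hk, hl, mul_smul, mul_assoc l]⟩
      inv_mem' := fun {a} ha x => by
        obtain ⟨k, hk⟩ := ha (a⁻¹ • x)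
        exact ⟨k⁻¹, fun m => by
          rw [_root_.map_inv, Equiv.Perm.inv_eq_iff_eq, hk, smul_inv_smul, mul_inv_cancel_left]⟩ }
  have hS (b : B3) : ∀ x, ∃ k : G, ∀ m, Φ b (x, m) = (b • x, k * m) :=
    mem_of_generators (S := S) (fun x => ⟨p x, fun m => hg _⟩) (fun x => ⟨q x, fun m => hr _⟩) b
  choose c hcc using hS
  refine ⟨c, fun a b x => ?_, fun x => ?_, fun x => ?_⟩
  · have h1 := hcc (a * b) x 1
    rw [map_mul, Equiv.Perm.mul_apply, hcc, hcc] at h1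
    simpa using (congrArg Prod.snd h1).symm
  · simpa using congrArg Prod.snd ((hcc garside x 1).symm.trans (hg _))
  · simpa using congrArg Prod.snd ((hcc rotation x 1).symm.trans (hr _))

/-! ### Cocycles with prescribed values on loops of the Schreier graph -/

section TrivialCenter

variable (hz : ∀ x : X, fullTwist • x = x)
include hz

theorem garside_garside_smul (x : X) : garside • garside • x = x := by
  rw [smul_smul]; exact hz x

theorem rotation_rotation_rotation_smul (x : X) : rotation • rotation • rotation • x = x := by
  rw [smul_smul, smul_smul, mul_assoc rotation, rotation_cubed, hz]

theorem garside_inv_smul (x : X) : garside⁻¹ • x = garside • x := by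
  rw [inv_smul_eq_iff, garside_garside_smul hz]

theorem rotation_inv_smul (x : X) : rotation⁻¹ • x = rotation • rotation • x := by
  rw [inv_smul_eq_iff, rotation_rotation_rotation_smul hz]

theorem rotation_smul_eq_self {x : X} (h : rotation • rotation • x = x) : rotation • x = x := by
  have := rotation_rotation_rotation_smul hz x
  rwa [h] at this

/-- A `B3`-valued cocycle that is central along a connected part of the Schreier graph of `X`,
takes the obvious values at the fixed points of the two generators of finite order, and prescribed
values `γ` at the fixed points of `σ₁`. -/
theorem exists_cocycle_of_loops [LinearOrder X] (γ : X → B3) :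
    ∃ c : B3 → X → B3, IsCocycle c ∧ (∀ x, c fullTwist x = fullTwist) ∧
      (∀ x, garside • x = x → c garside x = garside) ∧
      (∀ x, rotation • x = x → c rotation x = rotation) ∧
      (∀ x, garside • x = rotation • x → garside • x ≠ x →
        ∃ j : ℤ, c sigma1 x = fullTwist ^ j * γ x) ∧
      ∀ (a : B3) (x : X), ∃ (b : B3) (j : ℤ), b • x = a • x ∧ c b x = fullTwist ^ j := by
  classical
  have gg := garside_garside_smul hz
  have rrr := rotation_rotation_rotation_smul hz
  -- The second case is a Δ-edge parallel to a ρ-edge, that is, a fixed point of `σ₁`; the third is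
  -- the same edge traversed backwards. On the remaining edges the order only decides which
  -- direction carries the full twist, so that every round trip has product `fullTwist`.
  let p : X → B3 := fun x =>
    if garside • x = x then garside
    else if garside • x = rotation • x then γ x
    else if rotation • garside • x = x then (γ (garside • x))⁻¹ * fullTwist
    else if x < garside • x then fullTwist else 1
  -- In each ρ-triangle the smallest point carries the full twist, so the product around the
  -- triangle is again `fullTwist`.
  let q : X → B3 := fun x =>
    if rotation • x = x then rotation
    else if x < rotation • x ∧ x < rotation • rotation • x then fullTwist else 1
  have hp (x : X) : p (garside • x) * p x = fullTwist := by
    simp only [p, gg]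
    by_cases h₁ : garside • x = x
    · simp only [h₁, if_true]; rfl
    have h₁' : x ≠ garside • x := fun h => h₁ h.symm
    simp only [h₁, h₁', if_false]
    by_cases h₂ : garside • x = rotation • x
    · have h₃ : x ≠ rotation • garside • x := fun h => h₁ (by
        rw [h₂] at h ⊢
        exact rotation_smul_eq_self hz h.symm)
      simp only [h₂, h₂ ▸ h₃, if_false, if_true]
      rw [mul_assoc, fullTwist_comm, inv_mul_cancel_left]
    by_cases h₃ : rotation • garside • x = x
    · simp only [h₂, h₃, if_false, if_true]
      rw [mul_inv_cancel_left]
    · have h₃' : ¬ x = rotation • garside • x := fun h => h₃ h.symm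
      have h₂' : ¬ rotation • x = garside • x := fun h => h₂ h.symm
      simp only [h₂, h₂', h₃, h₃', if_false]
      rcases lt_or_gt_of_ne h₁' with h | h
      · simp [h, h.not_gt]
      · simp [h, h.not_gt]
  have hq (x : X) : q (rotation • rotation • x) * (q (rotation • x) * q x) = fullTwist := by
    simp only [q, rrr]
    by_cases h₁ : rotation • x = x
    · simp only [h₁, if_true]; exact rotation_cubed
    have h₂ : rotation • rotation • x ≠ rotation • x := fun h => h₁ (MulAction.injective _ h)
    have h₃ : x ≠ rotation • rotation • x := fun h => h₁ (rotation_smul_eq_self hz h.symm)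
    simp only [h₁, h₂, h₃, if_false]
    generalize rotation • rotation • x = r at *
    generalize rotation • x = s at *
    rcases lt_or_gt_of_ne h₁ with a₁ | a₁ <;> rcases lt_or_gt_of_ne h₂ with a₂ | a₂ <;>
      rcases lt_or_gt_of_ne h₃ with a₃ | a₃ <;> simp [a₁, a₂, a₃, a₁.not_gt, a₂.not_gt, a₃.not_gt]
    · exact absurd (a₁.trans (a₃.trans a₂)) (lt_irrefl _)
    · exact absurd (a₁.trans (a₂.trans a₃)) (lt_irrefl _)
  obtain ⟨c, hc, hcg, hcr⟩ := exists_cocycle p q (fun x => (hp x).trans (hq x).symm)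
  have hcr' {x : X} (h : rotation • x ≠ x) : ∃ j : ℤ, c rotation x = fullTwist ^ j := by
    rw [hcr]
    simp only [q, h, if_false]
    split_ifs
    exacts [⟨1, (zpow_one _).symm⟩, ⟨0, (zpow_zero _).symm⟩]
  refine ⟨c, hc, fun x => by rw [fullTwist, hc, hcg, hcg, hp]; rfl,
    fun x h => by simp [hcg, p, h], fun x h => by simp [hcr, q, h],
    fun x h h' => ?_, fun a => ?_⟩
  · rw [sigma1_eq, hc, hcg, hc.map_inv, h, inv_smul_smul]
    obtain ⟨j, hj⟩ := hcr' (h ▸ h')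
    refine ⟨-j, ?_⟩
    rw [hj, zpow_neg]
    simp only [p, h, if_false, if_true, h ▸ h']
  · have step_r (x : X) : ∃ (b : B3) (j : ℤ), b • x = rotation • x ∧ c b x = fullTwist ^ j := by
      by_cases h : rotation • x = x
      · exact ⟨1, 0, by rw [h, one_smul], by rw [hc.map_one, zpow_zero]⟩
      · obtain ⟨j, hj⟩ := hcr' h
        exact ⟨_, j, rfl, hj⟩
    have step_r' (x : X) : ∃ (b : B3) (j : ℤ), b • x = rotation⁻¹ • x ∧ c b x = fullTwist ^ j := by
      obtain ⟨b₁, j₁, h₁, e₁⟩ := step_r x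
      obtain ⟨b₂, j₂, h₂, e₂⟩ := step_r (b₁ • x)
      exact ⟨b₂ * b₁, j₂ + j₁, by rw [mul_smul, h₂, h₁, rotation_inv_smul hz],
        by rw [hc, e₁, e₂, zpow_add]⟩
    -- A Δ-edge with label from `γ` is bypassed along the parallel ρ-edges, whose labels are
    -- central.
    have step_g (x : X) : ∃ (b : B3) (j : ℤ), b • x = garside • x ∧ c b x = fullTwist ^ j := by
      by_cases h₁ : garside • x = x
      · exact ⟨1, 0, by rw [h₁, one_smul], by rw [hc.map_one, zpow_zero]⟩
      by_cases h₂ : garside • x = rotation • x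
      · rw [h₂]; exact step_r x
      by_cases h₃ : rotation • garside • x = x
      · have : garside • x = rotation⁻¹ • x := by rw [eq_inv_smul_iff, h₃]
        rw [this]; exact step_r' x
      refine ⟨garside, if x < garside • x then 1 else 0, rfl, ?_⟩
      rw [hcg]
      simp only [p, h₁, h₂, h₃, if_false]
      split_ifs
      exacts [(zpow_one _).symm, (zpow_zero _).symm]
    have trans {a b : B3} {x : X}
        (h : ∀ y : X, ∃ (d : B3) (j : ℤ), d • y = a • y ∧ c d y = fullTwist ^ j)
        (h' : ∃ (d : B3) (j : ℤ), d • x = b • x ∧ c d x = fullTwist ^ j) :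
        ∃ (d : B3) (j : ℤ), d • x = (a * b) • x ∧ c d x = fullTwist ^ j := by
      obtain ⟨d, j, hd, e⟩ := h'
      obtain ⟨d', j', hd', e'⟩ := h (d • x)
      exact ⟨d' * d, j' + j, by rw [mul_smul, hd', hd, mul_smul], by rw [hc, e, e', zpow_add]⟩
    intro x
    induction a using induction_left with
    | one => exact ⟨1, 0, rfl, by rw [hc.map_one, zpow_zero]⟩
    | garside_mul b h => exact trans step_g h
    | garside_inv_mul b h =>
      exact trans (fun y => by rw [garside_inv_smul hz]; exact step_g y) h
    | rotation_mul b h => exact trans step_r h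
    | rotation_inv_mul b h => exact trans step_r' h

end TrivialCenter

/-- Values of a cocycle at closed paths, modulo the center, when all points can be joined along
paths with central values. -/
theorem exists_surjective_of_cocycle [MulAction.IsPretransitive B3 X] {c : B3 → X → B3}
    (hc : IsCocycle c)
    (hconn : ∀ (a : B3) (x : X), ∃ (b : B3) (j : ℤ), b • x = a • x ∧ c b x = fullTwist ^ j)
    {s t : B3} (hst : ∀ S : Subgroup B3, s ∈ S → t ∈ S → S = ⊤)
    (hs : ∃ (a : B3) (x : X) (j : ℤ), a • x = x ∧ c a x = fullTwist ^ j * s)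
    (ht : ∃ (a : B3) (x : X) (j : ℤ), a • x = x ∧ c a x = fullTwist ^ j * t) (x₀ : X) (b : B3) :
    ∃ (a : B3) (j : ℤ), a • x₀ = x₀ ∧ c a x₀ = fullTwist ^ j * b := by
  let S : Subgroup B3 :=
    { carrier := {b | ∃ (a : B3) (j : ℤ), a • x₀ = x₀ ∧ c a x₀ = fullTwist ^ j * b}
      one_mem' := ⟨1, 0, one_smul _ _, by rw [hc.map_one]; simp⟩
      mul_mem' := by
        rintro b b' ⟨a, j, ha, e⟩ ⟨a', j', ha', e'⟩
        refine ⟨a * a', j + j', by rw [mul_smul, ha', ha], ?_⟩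
        rw [hc, ha', e, e', zpow_add, mul_assoc, ← mul_assoc b, ← fullTwist_zpow_comm _ b]
        simp only [mul_assoc]
      inv_mem' := by
        rintro b ⟨a, j, ha, e⟩
        have ha' : a⁻¹ • x₀ = x₀ := by rw [inv_smul_eq_iff, ha]
        refine ⟨a⁻¹, -j, ha', ?_⟩
        rw [hc.map_inv, ha', e, mul_inv_rev, fullTwist_zpow_comm, zpow_neg] }
  -- A loop at `x` is carried to `x₀` by conjugating with a path of central value, which does not
  -- change its value.
  have key {s : B3} (hs : ∃ (a : B3) (x : X) (j : ℤ), a • x = x ∧ c a x = fullTwist ^ j * s) :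
      s ∈ S := by
    obtain ⟨a, x, j, ha, e⟩ := hs
    obtain ⟨d, rfl⟩ := MulAction.exists_smul_eq B3 x₀ x
    obtain ⟨w, i, hw, e'⟩ := hconn d x₀
    rw [← hw] at ha e
    refine ⟨w⁻¹ * a * w, j, by rw [mul_smul, mul_smul, ha, inv_smul_smul], ?_⟩
    rw [hc, hc, ha, hc.map_inv, inv_smul_smul, e, e', mul_assoc, ← fullTwist_zpow_comm i,
      inv_mul_cancel_left]
  have := hst S (key hs) (key ht)
  exact (this ▸ Subgroup.mem_top b : b ∈ S)


/-! ### Normal form modulo the center -/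

/-- Braids which are an alternating product of Garside elements and nontrivial powers of the
rotation (modulo the center), starting with a Garside element. -/
inductive IsAlternating : B3 → Prop
  | base (i : ℤ) : IsAlternating (garside * rotation ^ i)
  | step (j : ℤ) (hj : ¬ 3 ∣ j) (g : B3) : IsAlternating g →
      IsAlternating (garside * (rotation ^ j * g))

/-- Normal form of braids modulo the center. -/
theorem exists_normal_form (g : B3) :
    (∃ i : ℤ, g = rotation ^ i) ∨
      ∃ (i : ℤ) (g' : B3), IsAlternating g' ∧ g = rotation ^ i * g' := by
  have hr {g : B3} (i : ℤ) (h : (∃ i : ℤ, g = rotation ^ i) ∨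
      ∃ (i : ℤ) (g' : B3), IsAlternating g' ∧ g = rotation ^ i * g') :
      (∃ j : ℤ, rotation ^ i * g = rotation ^ j) ∨
      ∃ (j : ℤ) (g' : B3), IsAlternating g' ∧ rotation ^ i * g = rotation ^ j * g' := by
    obtain ⟨j, rfl⟩ | ⟨j, g', h, rfl⟩ := h
    · exact .inl ⟨i + j, (zpow_add _ _ _).symm⟩
    · exact .inr ⟨i + j, g', h, by rw [zpow_add, mul_assoc (rotation ^ i)]⟩
  have hg {g : B3} (h : (∃ i : ℤ, g = rotation ^ i) ∨
      ∃ (i : ℤ) (g' : B3), IsAlternating g' ∧ g = rotation ^ i * g') :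
      (∃ j : ℤ, garside * g = rotation ^ j) ∨
      ∃ (j : ℤ) (g' : B3), IsAlternating g' ∧ garside * g = rotation ^ j * g' := by
    obtain ⟨j, rfl⟩ | ⟨j, g', h, rfl⟩ := h
    · exact .inr ⟨0, _, .base j, by rw [zpow_zero, one_mul]⟩
    by_cases hj : 3 ∣ j
    · obtain ⟨k, rfl⟩ := hj
      -- Here ρ³ᵏ is central and Δ² = ρ³, so two Garside letters merge into a power of ρ.
      have hk (b : B3) : garside * (rotation ^ (3 * k) * (garside * b)) =
          rotation ^ (3 * (k + 1)) * b := by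
        rw [zpow_mul, zpow_mul, rotation_zpow_three, ← mul_assoc, ← mul_assoc, ← fullTwist_zpow_comm,
          mul_assoc (fullTwist ^ k), ← fullTwist, ← zpow_add_one]
      cases h with
      | base i => exact .inl ⟨3 * (k + 1) + i, by rw [hk, zpow_add]⟩
      | step i hi g h => exact .inr ⟨3 * (k + 1) + i, g, h, by
          rw [hk, zpow_add, mul_assoc (rotation ^ _)]⟩
    · exact .inr ⟨0, _, .step j hj g' h, by rw [zpow_zero, one_mul]⟩
  induction g using induction_left with
  | one => exact .inl ⟨0, (zpow_zero _).symm⟩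
  | garside_mul b h => exact hg h
  | garside_inv_mul b h =>
    have : garside⁻¹ * b = garside * (rotation ^ (-3 : ℤ) * b) := by
      rw [zpow_neg, rotation_zpow_three, ← mul_assoc garside, fullTwist,
        mul_inv_rev garside garside, mul_inv_cancel_left]
    rw [this]
    exact hg (hr _ h)
  | rotation_mul b h => simpa using hr 1 h
  | rotation_inv_mul b h => simpa using hr (-1) h

/-! ### Free actions of Δ and ρ: a cocycle with values in a free group -/

section Free

variable [LinearOrder X] (hz : ∀ x : X, fullTwist • x = x)
  (hg : ∀ x : X, garside • x ≠ x) (hr : ∀ x : X, rotation • x ≠ x)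

/-- The letter recording a step `x ↦ garside • x`, oriented by the linear order on `X`. -/
def stepLetter (x : X) : X × Bool :=
  if x < garside • x then (x, true) else (garside • x, false)

include hz hg

theorem mk_stepLetter_garside_smul (x : X) :
    FreeGroup.mk [stepLetter (garside • x)] * FreeGroup.mk [stepLetter x] = 1 := by
  rw [stepLetter, stepLetter, garside_garside_smul hz]
  rcases lt_or_gt_of_ne (hg x) with h | h
  · rw [if_pos h, if_neg h.not_gt]
    exact FreeGroup.reduce.exact (by simp)
  · rw [if_pos h, if_neg h.not_gt]
    exact FreeGroup.reduce.exact (by simp)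

-- Two letters can cancel only when they record the same Δ-edge in opposite directions.
omit hg in
theorem stepLetter_snd_eq {x y : X} (hxy : x ≠ garside • y)
    (h : (stepLetter x).1 = (stepLetter y).1) : (stepLetter x).2 = (stepLetter y).2 := by
  have gg := garside_garside_smul hz
  unfold stepLetter at h ⊢
  split_ifs at h ⊢
  · rfl
  · exact absurd h hxy
  · exact absurd (by rw [← gg x]; exact congrArg (garside • ·) h) hxy
  · rfl

include hr

-- Since ρ³ acts trivially and ρ has no fixed point, every ρ-orbit has exactly three points.
omit [LinearOrder X] hg in
theorem rotation_zpow_smul_eq_self {j : ℤ} {x : X} (h : rotation ^ j • x = x) : 3 ∣ j := by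
  have h3 (k : ℤ) : rotation ^ (3 * k) • x = x := by
    have : rotation ^ (3 : ℤ) ∈ MulAction.stabilizer B3 x := by
      rw [MulAction.mem_stabilizer_iff, rotation_zpow_three, hz]
    rw [zpow_mul]
    exact zpow_mem this k
  obtain ⟨k, rfl | rfl | rfl⟩ : ∃ k, j = 3 * k ∨ j = 1 + 3 * k ∨ j = 2 + 3 * k :=
    ⟨j / 3, by omega⟩
  · exact dvd_mul_right _ _
  · rw [zpow_add, mul_smul, h3, zpow_one] at h
    exact absurd h (hr x)
  · rw [zpow_add, mul_smul, h3, zpow_two, mul_smul] at h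
    exact absurd (rotation_smul_eq_self hz h) (hr x)

/-- If the two generators of finite order act on `X` without fixed points, there is a cocycle with
values in a free group that detects braids modulo the center. -/
theorem exists_free_cocycle :
    ∃ c : B3 → X → FreeGroup X, IsCocycle c ∧
      ∀ g x, g • x = x → c g x = 1 → ∃ j : ℤ, g = fullTwist ^ j := by
  obtain ⟨c, hc, hcg, hcr⟩ := exists_cocycle (X := X) (G := FreeGroup X)
    -- Giving ρ the value 1 collapses the ρ-triangles; the Δ-edges of the resulting graph are the
    -- free letters.
    (fun x => FreeGroup.mk [stepLetter x]) (fun _ => 1) (fun x => by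
      rw [mk_stepLetter_garside_smul hz hg]; simp)
  refine ⟨c, hc, fun g x hgx hcx => ?_⟩
  have hcr' (i : ℤ) (y : X) : c (rotation ^ i) y = 1 := by
    let S : Subgroup B3 :=
      { carrier := {b | ∀ y, c b y = 1}
        one_mem' := hc.map_one
        mul_mem' := fun {a b} ha hb y => by rw [hc, ha, hb, mul_one]
        inv_mem' := fun {a} ha y => by rw [hc.map_inv, ha, inv_one] }
    exact zpow_mem (show rotation ∈ S from hcr) i y
  -- Between consecutive Δ-steps the point moves by ρʲ with `3 ∤ j`, so a step never retraces the
  -- previous one and the word stays reduced.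
  have key {g' : B3} (h : IsAlternating g') : ∃ (y : X) (L : List (X × Bool)),
      g' • x = garside • y ∧ c g' x = FreeGroup.mk (stepLetter y :: L) ∧
        FreeGroup.IsReduced (stepLetter y :: L) := by
    induction h with
    | base i =>
      exact ⟨rotation ^ i • x, [], mul_smul _ _ _, by rw [hc, hcg, hcr', mul_one],
        FreeGroup.IsReduced.singleton⟩
    | step j hj g h ih =>
      obtain ⟨y, L, e, e', hL⟩ := ih
      refine ⟨rotation ^ j • g • x, stepLetter y :: L, by rw [mul_smul, mul_smul], ?_, ?_⟩
      · rw [hc, hc, hcg, hcr', one_mul, e', FreeGroup.mul_mk, mul_smul, List.singleton_append]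
      · refine FreeGroup.isReduced_cons_cons.2 ⟨stepLetter_snd_eq hz fun h => hj ?_, hL⟩
        rw [← e] at h
        exact rotation_zpow_smul_eq_self hz hr h
  obtain ⟨i, rfl⟩ | ⟨i, g', h, rfl⟩ := exists_normal_form g
  · obtain ⟨k, rfl⟩ := rotation_zpow_smul_eq_self hz hr hgx
    exact ⟨k, by rw [zpow_mul, rotation_zpow_three]⟩
  · obtain ⟨y, L, -, e, hL⟩ := key h
    classical
    rw [hc, hcr', one_mul, e, ← FreeGroup.toWord_eq_nil_iff, FreeGroup.toWord_mk,
      hL.reduce_eq] at hcx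
    exact absurd hcx (List.cons_ne_nil _ _)

end Free

/-! ### Subgroups containing two conjugates of `σ₁` -/

/-- A group with a homomorphism to a free group with central kernel is commutative or maps onto
`B3`. -/
theorem exists_surjective_or_commute {H : Type*} {F : Type*} [Group H] [Group F] [IsFreeGroup F]
    (φ : H →* F) (hφ : φ.ker ≤ Subgroup.center H) :
    (∃ f : H →* B3, Function.Surjective f) ∨ ∀ a b : H, a * b = b * a := by
  classical
  by_cases hι : Nontrivial (IsFreeGroup.Generators φ.range)
  · left
    obtain ⟨i, j, hij⟩ := hι
    -- The range is free as a subgroup of a free group; two of its free generators are sent to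
    -- generators of `B3`.
    let f : φ.range →* B3 := IsFreeGroup.lift fun k => if k = i then garside else rotation
    refine ⟨f.comp φ.rangeRestrict, ?_⟩
    rw [MonoidHom.coe_comp]
    refine Function.Surjective.comp (fun b => ?_) φ.rangeRestrict_surjective
    refine mem_of_generators (S := f.range) ⟨IsFreeGroup.of i, ?_⟩ ⟨IsFreeGroup.of j, ?_⟩ b
    · rw [IsFreeGroup.lift_of, if_pos rfl]
    · rw [IsFreeGroup.lift_of, if_neg hij.symm]
  · right
    rw [not_nontrivial_iff_subsingleton] at hι
    have : IsCyclic (FreeGroup (IsFreeGroup.Generators φ.range)) := by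
      rcases isEmpty_or_nonempty (IsFreeGroup.Generators φ.range) with h | ⟨⟨i⟩⟩
      · infer_instance
      · refine ⟨FreeGroup.of i, fun x => ?_⟩
        have hx : x ∈ Subgroup.closure (Set.range FreeGroup.of) :=
          FreeGroup.closure_range_of _ ▸ Subgroup.mem_top x
        refine (Subgroup.closure_le (Subgroup.zpowers (FreeGroup.of i))).2 ?_ hx
        rintro _ ⟨k, rfl⟩
        rw [Subsingleton.elim k i]
        exact Subgroup.mem_zpowers _
    have : IsCyclic φ.range :=
      isCyclic_of_surjective (IsFreeGroup.mulEquiv φ.range) (IsFreeGroup.mulEquiv _).surjective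
    exact (φ.rangeRestrict.isMulCommutative_of_isCyclic_of_ker_le_center
      (by rwa [MonoidHom.ker_rangeRestrict])).is_comm.comm

/-- A subgroup `H` of `B3` that contains two different conjugates of `σ₁` maps onto `B3`. The proof
studies the action of `B3` on the cosets of `H` times the center. If a generator of finite order has
a fixed point there, or `σ₁` has two, cocycles give a map onto `B3`. Otherwise `H` is free modulo
its center and not commutative. -/
theorem exists_surjective_of_isConj_sigma1 (H : Subgroup B3) {a b : B3} (ha : a ∈ H) (hb : b ∈ H)
    (hca : IsConj sigma1 a) (hcb : IsConj sigma1 b) (hab : a ≠ b) :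
    ∃ f : H →* B3, Function.Surjective f := by
  classical
  obtain ⟨w, hw⟩ := isConj_iff.1 hca
  obtain ⟨w', hw'⟩ := isConj_iff.1 hcb
  have hN : (Subgroup.zpowers fullTwist).Normal := by
    refine ⟨fun n hn g => ?_⟩
    obtain ⟨j, rfl⟩ := hn
    refine ⟨j, ?_⟩
    change fullTwist ^ j = g * fullTwist ^ j * g⁻¹
    rw [← fullTwist_zpow_comm, mul_inv_cancel_right]
  let K := H ⊔ Subgroup.zpowers fullTwist
  have hHK : H ≤ K := le_sup_left
  have hzK : fullTwist ∈ K := (le_sup_right : _ ≤ K) (Subgroup.mem_zpowers _)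
  have mem_K {g : B3} (hg : g ∈ K) : ∃ h ∈ H, ∃ j : ℤ, g = h * fullTwist ^ j := by
    obtain ⟨h, hh, _, ⟨j, rfl⟩, e⟩ := Subgroup.mem_sup_of_normal_right.1 hg
    exact ⟨h, hh, j, e.symm⟩
  let x₀ : B3 ⧸ K := ((1 : B3) : B3 ⧸ K)
  have smul_x₀ (g : B3) : g • x₀ = x₀ ↔ g ∈ K := by
    change ((g * 1 : B3) : B3 ⧸ K) = ((1 : B3) : B3 ⧸ K) ↔ _
    rw [mul_one, QuotientGroup.eq, mul_one, inv_mem_iff]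
  have hz (x : B3 ⧸ K) : fullTwist • x = x := by
    obtain ⟨g, rfl⟩ := QuotientGroup.mk_surjective x
    change ((fullTwist * g : B3) : B3 ⧸ K) = _
    rw [fullTwist_comm]
    exact QuotientGroup.mk_mul_of_mem g hzK
  -- Any linear order will do; it only breaks ties in the edge labels.
  let : LinearOrder (B3 ⧸ K) := linearOrderOfSTO WellOrderingRel
  have fixed {w a : B3} (ha : a ∈ H) (hw : w * sigma1 * w⁻¹ = a) :
      sigma1 • w⁻¹ • x₀ = w⁻¹ • x₀ := by
    rw [eq_inv_smul_iff, smul_smul, smul_smul, hw, smul_x₀]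
    exact hHK ha
  have hy := fixed ha hw
  have hy' := fixed hb hw'
  have sigma1_smul {y : B3 ⧸ K} (h : sigma1 • y = y) : garside • y = rotation • y := by
    rwa [sigma1_eq, mul_smul, inv_smul_eq_iff] at h
  have of_cocycle (γ : B3 ⧸ K → B3) {s t : B3}
      (hst : ∀ S : Subgroup B3, s ∈ S → t ∈ S → S = ⊤)
      (hs : ((∃ x : B3 ⧸ K, garside • x = x) ∧ s = garside) ∨
        ((∃ x : B3 ⧸ K, rotation • x = x) ∧ s = rotation) ∨
        ∃ x : B3 ⧸ K, sigma1 • x = x ∧ garside • x ≠ x ∧ γ x = s)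
      (ht : ((∃ x : B3 ⧸ K, garside • x = x) ∧ t = garside) ∨
        ((∃ x : B3 ⧸ K, rotation • x = x) ∧ t = rotation) ∨
        ∃ x : B3 ⧸ K, sigma1 • x = x ∧ garside • x ≠ x ∧ γ x = t) :
      ∃ f : H →* B3, Function.Surjective f := by
    obtain ⟨c, hc, hcz, hcg, hcr, hcs, hconn⟩ := exists_cocycle_of_loops hz γ
    have value {s : B3} (hs : ((∃ x : B3 ⧸ K, garside • x = x) ∧ s = garside) ∨
        ((∃ x : B3 ⧸ K, rotation • x = x) ∧ s = rotation) ∨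
        ∃ x : B3 ⧸ K, sigma1 • x = x ∧ garside • x ≠ x ∧ γ x = s) :
        ∃ (a : B3) (x : B3 ⧸ K) (j : ℤ), a • x = x ∧ c a x = fullTwist ^ j * s := by
      obtain ⟨⟨x, hx⟩, rfl⟩ | ⟨⟨x, hx⟩, rfl⟩ | ⟨x, hx, hx', rfl⟩ := hs
      · exact ⟨_, x, 0, hx, by rw [hcg x hx, zpow_zero, one_mul]⟩
      · exact ⟨_, x, 0, hx, by rw [hcr x hx, zpow_zero, one_mul]⟩
      · obtain ⟨j, hj⟩ := hcs x (sigma1_smul hx) hx'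
        exact ⟨_, x, j, hx, hj⟩
    let φ : K →* B3 := hc.hom K x₀ fun g hg => (smul_x₀ g).2 hg
    refine exists_surjective_of_surjective_mod_center (φ.comp (Subgroup.inclusion hHK)) fun b => ?_
    obtain ⟨g, j, hg, e⟩ := exists_surjective_of_cocycle hc hconn hst (value hs) (value ht) x₀ b
    obtain ⟨h, hh, i, rfl⟩ := mem_K ((smul_x₀ g).1 hg)
    refine ⟨⟨h, hh⟩, j - i, ?_⟩
    have hzi : φ (⟨fullTwist, hzK⟩ ^ i) = fullTwist ^ i := by
      rw [map_zpow]
      exact congrArg (· ^ i) (hcz x₀)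
    have h1 : φ (Subgroup.inclusion hHK ⟨h, hh⟩ * ⟨fullTwist, hzK⟩ ^ i) = fullTwist ^ j * b := e
    rw [map_mul, hzi, fullTwist_zpow_comm, ← eq_mul_inv_iff_mul_eq] at h1
    rw [MonoidHom.comp_apply, h1, zpow_sub, mul_assoc]
  have gen (S : Subgroup B3) (hg : garside ∈ S) (hr : rotation ∈ S) : S = ⊤ :=
    eq_top_iff.2 fun b _ => mem_of_generators hg hr b
  -- Since `σ₁` fixes this point, Δ and ρ agree on it: if Δ fixes it, so does ρ, and no label from
  -- `γ` is needed.
  by_cases hgy : garside • w⁻¹ • x₀ = w⁻¹ • x₀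
  · have hry : rotation • w⁻¹ • x₀ = w⁻¹ • x₀ := by rw [← sigma1_smul hy, hgy]
    exact of_cocycle 1 gen (.inl ⟨⟨_, hgy⟩, rfl⟩) (.inr (.inl ⟨⟨_, hry⟩, rfl⟩))
  by_cases hg : ∃ x : B3 ⧸ K, garside • x = x
  · exact of_cocycle (fun _ => rotation) gen (.inl ⟨hg, rfl⟩) (.inr (.inr ⟨_, hy, hgy, rfl⟩))
  by_cases hr : ∃ x : B3 ⧸ K, rotation • x = x
  · exact of_cocycle (fun _ => garside) gen (.inr (.inr ⟨_, hy, hgy, rfl⟩)) (.inr (.inl ⟨hr, rfl⟩))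
  push Not at hg hr
  by_cases hyy : w⁻¹ • x₀ = w'⁻¹ • x₀
  · obtain ⟨c, hc, hcf⟩ := exists_free_cocycle hz hg hr
    refine (exists_surjective_or_commute
      (hc.hom H x₀ fun g hg => (smul_x₀ g).2 (hHK hg)) ?_).resolve_right fun hcomm => hab ?_
    · intro g hg
      obtain ⟨j, hj⟩ := hcf g x₀ ((smul_x₀ g).2 (hHK g.2)) hg
      rw [Subgroup.mem_center_iff]
      intro h
      apply Subtype.ext
      rw [Subgroup.coe_mul, Subgroup.coe_mul, hj, fullTwist_zpow_comm]
    -- Up to a full twist power, `w' * w⁻¹` is some `h ∈ H`, so `b` is the conjugate of `a` by `h`;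
    -- if `H` is commutative, `b = a`.
    · have hK : w' * w⁻¹ ∈ K := by
        rw [← smul_x₀, mul_smul, hyy, smul_inv_smul]
      obtain ⟨h, hh, j, e⟩ := mem_K hK
      have e' : w' = h * fullTwist ^ j * w := by rw [← e, inv_mul_cancel_right]
      have hah : a * h = h * a := congrArg Subtype.val (hcomm ⟨a, ha⟩ ⟨h, hh⟩)
      rw [← hw', e']
      calc a = h * a * h⁻¹ := by rw [← hah, mul_inv_cancel_right]
        _ = h * (w * sigma1 * w⁻¹ * fullTwist ^ j) * (fullTwist ^ j)⁻¹ * h⁻¹ := by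
          rw [hw]; simp only [mul_assoc, mul_inv_cancel_left]
        _ = h * (fullTwist ^ j * (w * sigma1 * w⁻¹)) * (fullTwist ^ j)⁻¹ * h⁻¹ := by
          rw [fullTwist_zpow_comm]
        _ = _ := by simp only [mul_inv_rev, mul_assoc]
  · exact of_cocycle (fun x => if x = w⁻¹ • x₀ then garside else rotation) gen
      (.inr (.inr ⟨_, hy, hg _, if_pos rfl⟩))
      (.inr (.inr ⟨_, hy', hg _, if_neg (Ne.symm hyy)⟩))

end B3

/-! ### From the coloring to the subgroup -/

theorem mainTheorem5 (K : Set S3) (hK : IsKnot K) (x : KnotComplement K)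
    (hcol : ∃ c : KnotGroup K x → B3,
      IsSimpleB3Coloring K x c ∧ IsNontrivialColoring K x c) :
    ∃ f : KnotGroup K x →* B3, Function.Surjective f := by
  obtain ⟨c, hc, m, m', hm, hm', hne, hne'⟩ := hcol
  -- Inverting the values turns an antihomomorphism into a homomorphism.
  obtain ⟨φ, hφ⟩ : ∃ φ : KnotGroup K x →* B3, ∀ g, φ g = c g ∨ φ g = (c g)⁻¹ := by
    obtain h | h := hc.isColoring
    · exact ⟨MonoidHom.mk' c h, fun g => .inl rfl⟩
    · exact ⟨MonoidHom.mk' (fun g => (c g)⁻¹) fun a b => by rw [h, mul_inv_rev], fun g => .inr rfl⟩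
  have halfTwist (g : KnotGroup K x) (hg : IsMeridian K x g) :
      ∃ a ∈ φ.range, IsConj B3.sigma1 a ∧ (a = c g ∨ a = (c g)⁻¹) := by
    have h₁ : c g ∈ φ.range := by
      obtain h | h := hφ g
      · exact ⟨g, h⟩
      · exact ⟨g⁻¹, by rw [map_inv, h, inv_inv]⟩
    obtain h | h := hc.meridian g hg
    · exact ⟨c g, h₁, h, .inl rfl⟩
    · refine ⟨(c g)⁻¹, inv_mem h₁, ?_, .inr rfl⟩
      obtain ⟨w, hw⟩ := isConj_iff.1 h
      exact isConj_iff.2 ⟨w, by rw [← hw]; group⟩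
  obtain ⟨a, ha, hca, ea⟩ := halfTwist m hm
  obtain ⟨b, hb, hcb, eb⟩ := halfTwist m' hm'
  -- Replacing colors by inverses to reach conjugates of `σ₁` keeps them distinct because
  -- non-triviality compares colors up to inversion.
  have hab : a ≠ b := by
    rintro rfl
    obtain ea | ea := ea <;> obtain eb | eb := eb <;> rw [ea] at eb
    · exact hne eb
    · exact hne' eb
    · exact hne' (inv_eq_iff_eq_inv.1 eb)
    · exact hne (inv_injective eb)
  obtain ⟨f, hf⟩ := B3.exists_surjective_of_isConj_sigma1 φ.range ha hb hca hcb hab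
  exact ⟨f.comp φ.rangeRestrict, hf.comp φ.rangeRestrict_surjective⟩
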